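/- Let $p$ be a prime number such that $p \equiv 5 \pmod 8$ and $p \equiv \pm 1 \pmod 5$. Then $p = a^2 + b^2$ for some integers $a, b$, and this decomposition is unique up to the order and the signs of $a$ and $b$. (a) After interchanging $a$ and $b$ and changing signs, if necessary, one has $a \equiv 3 \pmod 4$ and $b$ even. (b) Assume that $a$ and $b$ are normalized as in (a). Then only the following eight possibilities exist for the pair of residues of $(a, b)$ modulo $20$. (i) $a \equiv 3, 7, 11$ or $19 \pmod{20}$ and $b \equiv 10 \pmod{20}$. In this case, $5^{(p-1)/4} \equiv 1 \pmod p$, and $5$ is a quartic residue modulo $p$, i.e. $x^4 \equiv 5 \pmod p$ has a solution $x \in \mathbb{Z}$. (ii) $a \equiv 15 \pmod{20}$ and $b \equiv 2, 6, 14$ or $18 \pmod{20}$. In this case, $5^{(p-1)/4} \equiv -1 \pmod p$, and $5$ is a quadratic but not a quartic residue modulo $p$. In particular, $b \equiv 10 \pmod{20}$ already implies case (i), and $a \equiv 15 \pmod{20}$ already implies case (ii). Each of the eight possibilities occurs for some such prime $p$, so that exactly eight residue patterns modulo $20$ occur. -/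

import Mathlib

/-- `p` is a prime number with `p ≡ 5 (mod 8)` and `p ≡ ±1 (mod 5)`. -/
def AdmissiblePrime (p : ℕ) : Prop :=
  p.Prime ∧ (p : ℤ) ≡ 5 [ZMOD 8] ∧ ((p : ℤ) ≡ 1 [ZMOD 5] ∨ (p : ℤ) ≡ -1 [ZMOD 5])

/-- The pairs `(a, b)` and `(c, d)` agree up to order and signs. -/
def AgreeUpToOrderAndSigns (a b c d : ℤ) : Prop :=
  ((c = a ∨ c = -a) ∧ (d = b ∨ d = -b)) ∨ ((c = b ∨ c = -b) ∧ (d = a ∨ d = -a))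

/-- The normalization `a ≡ 3 (mod 4)` and `b` even. -/
def NormalizedPair (a b : ℤ) : Prop :=
  a ≡ 3 [ZMOD 4] ∧ Even b

/-- `n` is an `m`-th power residue modulo `p`. -/
def IsPowerResidue (m : ℕ) (n : ℤ) (p : ℕ) : Prop :=
  ∃ x : ℤ, x ^ m ≡ n [ZMOD p]

/-! Let `r ^ 2 = 5` and `i ^ 2 = -1` in `ZMod p`, and let χ be the quadratic character. Then `5 ^
((p - 1) / 4) = r ^ ((p - 1) / 2) = χ(r)`, so everything reduces to χ(r). With `e = (5 + r) / 2`,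
the identity `(e + i r)² = r (1 + 2i) e` gives χ(r) = χ(e) χ(1 + 2i). As -1 is a square and `-e` is
the square of a difference `ζ - ζ⁻¹` of fifth roots of unity, χ(e) = 1 exactly when `p ≡ 1 (mod 5)`.
For `p = a² + b²` with `a` odd, take `i = -b / a`. Since (a/p) = 1, χ(1 + 2i) is the Jacobi symbol
of `a - 2b` over `p`, which reciprocity turns into its symbol over 5. A finite check modulo 5
finishes (`AdmissiblePrime.quadraticChar_sqrt_five`). -/

/-! ### Square roots of 5 and fifth roots of unity -/

/-- If `-(5 + r) / 2` is a square, where `r ^ 2 = 5`, then there is a nontrivial fifth root of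
unity. -/
theorem exists_pow_five_eq_one_of_isSquare {F : Type*} [Field F] (h2 : (2 : F) ≠ 0)
    (h5 : (5 : F) ≠ 0) {r : F} (hr : r ^ 2 = 5) (h : IsSquare (-((5 + r) / 2))) :
    ∃ z : F, z ^ 5 = 1 ∧ z ≠ 1 := by
  obtain ⟨s, hs⟩ := h
  -- `c` and `s` play the roles of `z + z⁻¹` and `z - z⁻¹`.
  obtain ⟨c, hc⟩ : ∃ c : F, 2 * c = -1 + r := ⟨(-1 + r) / 2, by field_simp⟩
  obtain ⟨z, hz⟩ : ∃ z : F, 2 * z = c + s := ⟨(c + s) / 2, by field_simp⟩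
  have h4 : (4 : F) ≠ 0 := by
    have : (4 : F) = 2 * 2 := by norm_num
    rw [this]; exact mul_ne_zero h2 h2
  have hs' : 2 * s ^ 2 = -(5 + r) := by
    rw [pow_two, ← hs]; field_simp
  have hcc : c ^ 2 + c - 1 = 0 := by
    apply mul_left_cancel₀ h4
    linear_combination (2 * c + r + 1) * hc + hr
  have hsc : s ^ 2 = c ^ 2 - 4 := by
    apply mul_left_cancel₀ h2
    linear_combination hs' - 2 * hcc + hc
  have hzz : z ^ 2 - c * z + 1 = 0 := by
    apply mul_left_cancel₀ h4
    linear_combination (2 * z + c + s) * hz - 2 * c * hz + hsc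
  refine ⟨z, ?_, ?_⟩
  · linear_combination (z - 1) * ((z ^ 2 + (c + 1) * z + 1) * hzz + z ^ 2 * hcc)
  · rintro rfl
    apply h5
    linear_combination hcc + (c + 3) * hzz

/-- If there is a nontrivial fifth root of unity, then `-(5 + r) / 2` is a square whenever
`r ^ 2 = 5`. -/
theorem isSquare_of_pow_five_eq_one {F : Type*} [Field F] (h2 : (2 : F) ≠ 0)
    {r : F} (hr : r ^ 2 = 5) {z : F} (hz : z ^ 5 = 1) (hz1 : z ≠ 1) :
    IsSquare (-((5 + r) / 2)) := by
  have hcyc : z ^ 4 + z ^ 3 + z ^ 2 + z + 1 = 0 := by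
    apply mul_left_cancel₀ (sub_ne_zero.2 hz1)
    linear_combination hz
  -- `z + z⁻¹` is a root of `X² + X - 1`, hence equals `(-1 ± r) / 2`; the sign decides whether `z`
  -- or `z²` supplies the square root.
  have hprod : (2 * (z + z ^ 4) + 1 - r) * (2 * (z + z ^ 4) + 1 + r) = 0 := by
    linear_combination 4 * hcyc - hr + (4 * z ^ 3 + 8) * hz
  rcases mul_eq_zero.1 hprod with h | h
  · refine ⟨z - z ^ 4, ?_⟩
    apply mul_left_cancel₀ h2
    field_simp
    linear_combination h - 2 * hcyc + (4 - 2 * z ^ 3) * hz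
  · refine ⟨z ^ 2 - z ^ 3, ?_⟩
    apply mul_left_cancel₀ h2
    field_simp
    linear_combination (-1) * h + (4 - 2 * z) * hz

theorem exists_pow_five_eq_one_iff {p : ℕ} [Fact p.Prime] :
    (∃ z : ZMod p, z ^ 5 = 1 ∧ z ≠ 1) ↔ 5 ∣ p - 1 := by
  have : Fact (Nat.Prime 5) := ⟨by norm_num⟩
  constructor
  · rintro ⟨z, hz, hz1⟩
    have h0 : z ≠ 0 := by rintro rfl; simp at hz
    rw [← orderOf_eq_prime hz hz1]
    exact ZMod.orderOf_dvd_card_sub_one h0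
  · intro h
    have hc : 5 ∣ Fintype.card (ZMod p)ˣ := by rwa [ZMod.card_units]
    obtain ⟨u, hu⟩ := exists_prime_orderOf_dvd_card 5 hc
    refine ⟨u, ?_, ?_⟩
    · rw [← Units.val_pow_eq_pow_val, ← hu, pow_orderOf_eq_one]; simp
    · intro h1
      rw [Units.val_eq_one] at h1
      simp [h1] at hu

/-- The quadratic character of a square root of `5`, in terms of a square root of `-1`. -/
theorem quadraticChar_sqrt_five {p : ℕ} [Fact p.Prime] (hp : p % 4 = 1) (hp5 : p ≠ 5)
    {r i : ZMod p} (hr : r ^ 2 = 5) (hi : i ^ 2 = -1) :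
    quadraticChar (ZMod p) r =
      (if 5 ∣ p - 1 then 1 else -1) * quadraticChar (ZMod p) (1 + 2 * i) := by
  have h2 : (2 : ZMod p) ≠ 0 := by
    intro h
    have := (ZMod.natCast_eq_zero_iff 2 p).1 (by exact_mod_cast h)
    have := (Nat.prime_dvd_prime_iff_eq Fact.out Nat.prime_two).1 this
    omega
  have h5 : (5 : ZMod p) ≠ 0 := by
    intro h
    have := (ZMod.natCast_eq_zero_iff 5 p).1 (by exact_mod_cast h)
    exact hp5 ((Nat.prime_dvd_prime_iff_eq Fact.out Nat.prime_five).1 this)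
  have hr0 : r ≠ 0 := by rintro rfl; apply h5; rw [← hr]; simp
  have hi0 : 1 + 2 * i ≠ 0 := by
    intro h; apply h5; linear_combination (1 - 2 * i) * h + 4 * hi
  set e : ZMod p := (5 + r) / 2 with he
  have he2 : 2 * e = 5 + r := by rw [he]; field_simp
  have he0 : e ≠ 0 := by
    intro h
    have h20 : (2 : ZMod p) * 2 * 5 = 0 := by
      rw [h] at he2
      linear_combination (-5 + r) * he2 + hr
    exact mul_ne_zero (mul_ne_zero h2 h2) h5 h20
  have hsq : (e + i * r) ^ 2 = r * (1 + 2 * i) * e := by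
    apply mul_left_cancel₀ (mul_ne_zero h2 h2)
    linear_combination (2 * e + 5 - r) * he2 + 4 * r ^ 2 * hi - 5 * hr
  have hm1 : quadraticChar (ZMod p) (-1) = 1 := by
    rw [quadraticChar_one_iff_isSquare (neg_ne_zero.2 one_ne_zero)]
    exact ⟨i, by rw [← hi, pow_two]⟩
  have hce : quadraticChar (ZMod p) e = if 5 ∣ p - 1 then 1 else -1 := by
    have hneg : quadraticChar (ZMod p) e = quadraticChar (ZMod p) (-e) := by
      rw [neg_eq_neg_one_mul, map_mul, hm1, one_mul]
    have hiff : IsSquare (-e) ↔ 5 ∣ p - 1 := by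
      rw [← exists_pow_five_eq_one_iff]
      exact ⟨exists_pow_five_eq_one_of_isSquare h2 h5 hr,
        fun ⟨z, hz, hz1⟩ => isSquare_of_pow_five_eq_one h2 hr hz hz1⟩
    rw [hneg]
    split_ifs with h
    · exact (quadraticChar_one_iff_isSquare (neg_ne_zero.2 he0)).2 (hiff.2 h)
    · exact quadraticChar_neg_one_iff_not_isSquare.2 (fun h' => h (hiff.1 h'))
  have hprod : quadraticChar (ZMod p) r * quadraticChar (ZMod p) (1 + 2 * i) *
      quadraticChar (ZMod p) e = 1 := by
    rw [← map_mul, ← map_mul, ← hsq]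
    refine quadraticChar_sq_one' fun h => ?_
    rw [h] at hsq
    exact mul_ne_zero (mul_ne_zero hr0 hi0) he0 (by rw [← hsq]; simp)
  have hi2 := quadraticChar_sq_one hi0
  have he2' := quadraticChar_sq_one he0
  rw [← hce]
  linear_combination (quadraticChar (ZMod p) (1 + 2 * i) * quadraticChar (ZMod p) e) * hprod -
    quadraticChar (ZMod p) r * quadraticChar (ZMod p) e ^ 2 * hi2 -
    quadraticChar (ZMod p) r * he2'

/-! ### Jacobi symbols attached to a sum of two squares -/

theorem jacobiSym_natAbs {p : ℕ} (hp : p % 4 = 1) (x : ℤ) :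
    jacobiSym x p = jacobiSym x.natAbs p := by
  rcases Int.natAbs_eq x with h | h
  · rw [← h]
  · conv_lhs => rw [h]
    rw [jacobiSym.neg _ (Nat.odd_iff.2 (by omega)), ZMod.χ₄_nat_one_mod_four hp, one_mul]

theorem jacobiSym_eq_of_odd {p : ℕ} (hp : p % 4 = 1) {x : ℤ} (hx : Odd x) :
    jacobiSym x p = jacobiSym p x.natAbs := by
  rw [jacobiSym_natAbs hp, jacobiSym.quadratic_reciprocity_one_mod_four' (Int.natAbs_odd.2 hx) hp]

theorem isCoprime_of_prime_eq_sq_add_sq {p : ℕ} (hp : p.Prime) {a b : ℤ}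
    (h : (p : ℤ) = a ^ 2 + b ^ 2) : IsCoprime a b := by
  rw [Int.isCoprime_iff_gcd_eq_one]
  by_contra hg
  obtain ⟨q, hq, hqg⟩ := Nat.exists_prime_and_dvd hg
  have hqa : (q : ℤ) ∣ a := (Int.natCast_dvd_natCast.2 hqg).trans (Int.gcd_dvd_left _ _)
  have hqb : (q : ℤ) ∣ b := (Int.natCast_dvd_natCast.2 hqg).trans (Int.gcd_dvd_right _ _)
  have hqp : (q ^ 2 : ℤ) ∣ p := by
    rw [h]; exact dvd_add (pow_dvd_pow_of_dvd hqa 2) (pow_dvd_pow_of_dvd hqb 2)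
  have hqp' : q * q ∣ p := by rw [← pow_two]; exact_mod_cast hqp
  have := (Nat.prime_dvd_prime_iff_eq hq hp).1 ((dvd_mul_right q q).trans hqp')
  subst this
  have := Nat.le_of_dvd hp.pos hqp'
  nlinarith [hq.two_le]

/-- By reciprocity the symbol is that of `p` over `|a|`, and `p ≡ b² (mod a)` with `b` prime to `a`.
-/
theorem jacobiSym_left_of_eq_sq_add_sq {p : ℕ} (hp : p.Prime) (hp4 : p % 4 = 1) {a b : ℤ}
    (h : (p : ℤ) = a ^ 2 + b ^ 2) (ha : Odd a) : jacobiSym a p = 1 := by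
  rw [jacobiSym_eq_of_odd hp4 ha]
  have hc := (isCoprime_of_prime_eq_sq_add_sq hp h).symm
  rw [jacobiSym.mod_left' (a₂ := b ^ 2), jacobiSym.sq_one']
  · rw [Int.isCoprime_iff_gcd_eq_one] at hc
    simpa only [Int.gcd, Int.natAbs_natCast] using hc
  · rw [h, Int.natCast_natAbs, Int.emod_abs, Int.emod_abs]
    exact Int.emod_eq_emod_iff_emod_sub_eq_zero.2 (Int.emod_eq_zero_of_dvd ⟨a, by ring⟩)

/-- From `5p = (2a + b)² + (a - 2b)²`, the product `5p` is a square modulo `a - 2b`, so 5 and `p`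
have the same symbol over `|a - 2b|`; reciprocity applies to both. -/
theorem jacobiSym_sub_two_mul {p : ℕ} (hp : p.Prime) (hp4 : p % 4 = 1) {a b : ℤ}
    (h : (p : ℤ) = a ^ 2 + b ^ 2) (ha : Odd a) (h5 : ¬ (5 : ℤ) ∣ a - 2 * b) :
    jacobiSym (a - 2 * b) p = jacobiSym (a - 2 * b) 5 := by
  have hodd : Odd (a - 2 * b) := ha.sub_even (even_two_mul b)
  have hc := isCoprime_of_prime_eq_sq_add_sq hp h
  have h5' : IsCoprime (5 : ℤ) (a - 2 * b) :=
    (Int.prime_iff_natAbs_prime.2 (by norm_num)).coprime_iff_not_dvd.2 h5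
  have hcop : IsCoprime (2 * a + b) (a - 2 * b) := by
    obtain ⟨u, v, huv⟩ := hc
    obtain ⟨s, t, hst⟩ := h5'
    exact ⟨s * (2 * u + v), s * (u - 2 * v) + t, by linear_combination hst + 5 * s * huv⟩
  have h5p : jacobiSym 5 (a - 2 * b).natAbs * jacobiSym p (a - 2 * b).natAbs = 1 := by
    rw [← jacobiSym.mul_left, jacobiSym.mod_left' (a₂ := (2 * a + b) ^ 2), jacobiSym.sq_one']
    · rw [Int.isCoprime_iff_gcd_eq_one] at hcop
      simpa only [Int.gcd, Int.natAbs_natCast] using hcop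
    · rw [h, Int.natCast_natAbs, Int.emod_abs, Int.emod_abs]
      exact Int.emod_eq_emod_iff_emod_sub_eq_zero.2
        (Int.emod_eq_zero_of_dvd ⟨a - 2 * b, by ring⟩)
  have h55 : jacobiSym 5 (a - 2 * b).natAbs = jacobiSym (a - 2 * b) 5 :=
    (jacobiSym_eq_of_odd (p := 5) (by norm_num) hodd).symm
  rw [jacobiSym_eq_of_odd hp4 hodd, ← h55]
  have hsq : jacobiSym 5 (a - 2 * b).natAbs ^ 2 = 1 := by
    apply jacobiSym.sq_one
    rw [Int.isCoprime_iff_gcd_eq_one] at h5'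
    simpa only [Int.gcd, Int.natAbs_natCast] using h5'
  linear_combination jacobiSym 5 (a - 2 * b).natAbs * h5p -
    jacobiSym p (a - 2 * b).natAbs * hsq

/-! ### Consequences of the congruences on `p` -/

theorem AdmissiblePrime.exists_sqrt_five {p : ℕ} (h : AdmissiblePrime p) :
    ∃ r : ZMod p, r ^ 2 = 5 := by
  obtain ⟨hp, h8, h5⟩ := h
  have : Fact p.Prime := ⟨hp⟩
  have : Fact (Nat.Prime 5) := ⟨by norm_num⟩
  have h2 : p ≠ 2 := by rintro rfl; revert h8; decide
  have hsq : IsSquare ((5 : ℕ) : ZMod p) := by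
    rw [← ZMod.exists_sq_eq_prime_iff_of_mod_four_eq_one (p := 5) (q := p) (by norm_num) h2]
    rcases h5 with h | h
    · have h' := (ZMod.intCast_eq_intCast_iff _ _ 5).2 h
      push_cast at h'
      rw [h']; exact ⟨1, rfl⟩
    · have h' := (ZMod.intCast_eq_intCast_iff _ _ 5).2 h
      push_cast at h'
      rw [h']; exact ⟨2, rfl⟩
  obtain ⟨r, hr⟩ := hsq
  exact ⟨r, by rw [pow_two, ← hr]; norm_num⟩

theorem AdmissiblePrime.residues {p : ℕ} (h : AdmissiblePrime p) {a b : ℤ}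
    (hab : (p : ℤ) = a ^ 2 + b ^ 2) (hn : NormalizedPair a b) :
    ((a ≡ 3 [ZMOD 20] ∨ a ≡ 7 [ZMOD 20] ∨ a ≡ 11 [ZMOD 20] ∨ a ≡ 19 [ZMOD 20]) ∧
        b ≡ 10 [ZMOD 20]) ∨
      (a ≡ 15 [ZMOD 20] ∧
        (b ≡ 2 [ZMOD 20] ∨ b ≡ 6 [ZMOD 20] ∨ b ≡ 14 [ZMOD 20] ∨ b ≡ 18 [ZMOD 20])) := by
  obtain ⟨-, h8, h5⟩ := h
  obtain ⟨ha, c, rfl⟩ := hn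
  rw [hab] at h8 h5
  obtain ⟨k, rfl⟩ : ∃ k, a = 4 * k + 3 := ⟨a / 4, by simp only [Int.ModEq] at ha; omega⟩
  -- Modulo 8 the odd square is 1, so `b² ≡ 4` and `b ≡ 2 (mod 4)`.
  have hc : c % 2 = 1 := by
    rcases Int.even_or_odd' c with ⟨m, rfl | rfl⟩
    · exfalso
      simp only [Int.ModEq] at h8
      ring_nf at h8
      omega
    · omega
  -- Nonzero squares modulo 5 are ±1, so a sum equal to ±1 has exactly one zero term.
  have h5' : ((4 * k + 3) % 5 = 0 ∧ c % 5 ≠ 0) ∨ ((4 * k + 3) % 5 ≠ 0 ∧ c % 5 = 0) := by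
    have key : ∀ x y : ZMod 5, (x ^ 2 + (y + y) ^ 2 = 1 ∨ x ^ 2 + (y + y) ^ 2 = -1) →
        (x = 0 ∧ y ≠ 0) ∨ (x ≠ 0 ∧ y = 0) := by decide
    have h5'' := key ((4 * k + 3 : ℤ) : ZMod 5) (c : ZMod 5) (by
      rcases h5 with h | h
      · left; exact_mod_cast (ZMod.intCast_eq_intCast_iff _ _ 5).2 h
      · right; exact_mod_cast (ZMod.intCast_eq_intCast_iff _ _ 5).2 h)
    have hz : ∀ x : ℤ, (x : ZMod 5) = 0 ↔ x % 5 = 0 := fun x => by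
      rw [ZMod.intCast_zmod_eq_zero_iff_dvd]; omega
    simpa only [ne_eq, hz] using h5''
  simp only [Int.ModEq]
  omega

/-- The value of the quartic symbol of `5`. -/
theorem AdmissiblePrime.quadraticChar_sqrt_five {p : ℕ} [Fact p.Prime] (h : AdmissiblePrime p)
    {a b : ℤ} (hab : (p : ℤ) = a ^ 2 + b ^ 2) (ha : Odd a) {r : ZMod p} (hr : r ^ 2 = 5) :
    ((5 : ℤ) ∣ b → quadraticChar (ZMod p) r = 1) ∧
      ((5 : ℤ) ∣ a → quadraticChar (ZMod p) r = -1) := by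
  obtain ⟨hp, h8, h5⟩ := h
  simp only [Int.ModEq] at h8
  have hp4 : p % 4 = 1 := by omega
  have hp5 : p ≠ 5 := by rintro rfl; revert h5; decide
  have hj := jacobiSym_left_of_eq_sq_add_sq hp hp4 hab ha
  have ha0 : (a : ZMod p) ≠ 0 := by
    intro h0
    rw [← jacobiSym.legendreSym.to_jacobiSym, (legendreSym.eq_zero_iff p a).2 h0] at hj
    exact absurd hj (by norm_num)
  have habz : (a : ZMod p) ^ 2 + (b : ZMod p) ^ 2 = 0 := by
    have := congrArg (Int.cast : ℤ → ZMod p) hab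
    push_cast at this
    rw [← this]; simp
  have hi : (-(b : ZMod p) / a) ^ 2 = -1 := by
    field_simp
    linear_combination habz
  have h12 : quadraticChar (ZMod p) (1 + 2 * (-(b : ZMod p) / a)) = jacobiSym (a - 2 * b) p := by
    have : ((a - 2 * b : ℤ) : ZMod p) = (a : ZMod p) * (1 + 2 * (-(b : ZMod p) / a)) := by
      push_cast; field_simp; ring
    have hA : quadraticChar (ZMod p) a = 1 := by
      rw [← hj, ← jacobiSym.legendreSym.to_jacobiSym, legendreSym]
    rw [← jacobiSym.legendreSym.to_jacobiSym, legendreSym, this, map_mul, hA, one_mul]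
  have hmain := _root_.quadraticChar_sqrt_five hp4 hp5 hr hi
  have hj5 : jacobiSym (a - 2 * b) p = jacobiSym (((a - 2 * b : ℤ) : ZMod 5).val : ℤ) 5 ∨
      (5 : ℤ) ∣ a - 2 * b := by
    by_cases hd : (5 : ℤ) ∣ a - 2 * b
    · exact Or.inr hd
    · left
      rw [jacobiSym_sub_two_mul hp hp4 hab ha hd, jacobiSym.mod_left, ZMod.val_intCast]
  have hz : ∀ x : ℤ, (5 : ℤ) ∣ x ↔ (x : ZMod 5) = 0 := fun x =>
    (ZMod.intCast_zmod_eq_zero_iff_dvd x 5).symm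
  rw [hz] at hj5
  -- 1 and 4 are the nonzero squares modulo 5, 2 and 3 the nonsquares. In the cases with `p ≡ -1`
  -- the factor χ(e) = -1 reverses the sign.
  have key : ∀ x y : ZMod 5,
      (y = 0 → x ^ 2 + y ^ 2 = 1 → x - 2 * y = 1 ∨ x - 2 * y = 4) ∧
      (y = 0 → x ^ 2 + y ^ 2 = -1 → x - 2 * y = 2 ∨ x - 2 * y = 3) ∧
      (x = 0 → x ^ 2 + y ^ 2 = 1 → x - 2 * y = 2 ∨ x - 2 * y = 3) ∧
      (x = 0 → x ^ 2 + y ^ 2 = -1 → x - 2 * y = 1 ∨ x - 2 * y = 4) := by decide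
  obtain ⟨k1, k2, k3, k4⟩ := key (a : ZMod 5) (b : ZMod 5)
  have hpos : ((a - 2 * b : ℤ) : ZMod 5) = 1 ∨ ((a - 2 * b : ℤ) : ZMod 5) = 4 →
      jacobiSym (a - 2 * b) p = 1 := by
    rintro (h | h) <;> rw [h] at hj5
    · exact (hj5.resolve_right (by decide)).trans (by decide +kernel)
    · exact (hj5.resolve_right (by decide)).trans (by decide +kernel)
  have hneg : ((a - 2 * b : ℤ) : ZMod 5) = 2 ∨ ((a - 2 * b : ℤ) : ZMod 5) = 3 →
      jacobiSym (a - 2 * b) p = -1 := by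
    rintro (h | h) <;> rw [h] at hj5
    · exact (hj5.resolve_right (by decide)).trans (by decide +kernel)
    · exact (hj5.resolve_right (by decide)).trans (by decide +kernel)
  rw [h12] at hmain
  rw [hz, hz, hmain]
  push_cast at hpos hneg
  rcases h5 with h5 | h5
  · have hd : 5 ∣ p - 1 := by simp only [Int.ModEq] at h5; omega
    have h5' : (a : ZMod 5) ^ 2 + (b : ZMod 5) ^ 2 = 1 := by
      rw [hab] at h5
      exact_mod_cast (ZMod.intCast_eq_intCast_iff _ _ 5).2 h5
    rw [if_pos hd, one_mul]
    exact ⟨fun hb => hpos (k1 hb h5'), fun ha => hneg (k3 ha h5')⟩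
  · have hd : ¬ 5 ∣ p - 1 := by simp only [Int.ModEq] at h5; omega
    have h5' : (a : ZMod 5) ^ 2 + (b : ZMod 5) ^ 2 = -1 := by
      rw [hab] at h5
      exact_mod_cast (ZMod.intCast_eq_intCast_iff _ _ 5).2 h5
    rw [if_neg hd]
    exact ⟨fun hb => by rw [hneg (k2 hb h5')]; norm_num,
      fun ha => by rw [hpos (k4 ha h5')]; norm_num⟩

/-! ### Uniqueness and normalization of the decomposition -/

/-- `p` divides `ad - bc` or `ad + bc`. Since `p² = (ad ∓ bc)² + (ac ± bd)²`, a term divisible by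
`p` forces one of the two terms to vanish. -/
theorem agreeUpToOrderAndSigns_of_prime {p : ℕ} (hp : p.Prime) {a b c d : ℤ}
    (hab : (p : ℤ) = a ^ 2 + b ^ 2) (hcd : (p : ℤ) = c ^ 2 + d ^ 2) :
    AgreeUpToOrderAndSigns a b c d := by
  have hp0 : (p : ℤ) ≠ 0 := by exact_mod_cast hp.ne_zero
  have hpp : Prime (p : ℤ) := Nat.prime_iff_prime_int.1 hp
  have same : (a * d) ^ 2 = (b * c) ^ 2 → AgreeUpToOrderAndSigns a b c d := fun h => by
    have h1 : c ^ 2 = a ^ 2 := mul_left_cancel₀ hp0 (by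
      linear_combination c ^ 2 * hab - a ^ 2 * hcd - h)
    exact Or.inl ⟨sq_eq_sq_iff_eq_or_eq_neg.1 h1,
      sq_eq_sq_iff_eq_or_eq_neg.1 (by linear_combination hab - hcd - h1)⟩
  have swap : (a * c) ^ 2 = (b * d) ^ 2 → AgreeUpToOrderAndSigns a b c d := fun h => by
    have h1 : d ^ 2 = a ^ 2 := mul_left_cancel₀ hp0 (by
      linear_combination d ^ 2 * hab - a ^ 2 * hcd - h)
    exact Or.inr ⟨sq_eq_sq_iff_eq_or_eq_neg.1 (by linear_combination hab - hcd - h1),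
      sq_eq_sq_iff_eq_or_eq_neg.1 h1⟩
  have small : ∀ x y : ℤ, (p : ℤ) ∣ x → x ^ 2 + y ^ 2 = p ^ 2 → x = 0 ∨ y = 0 := by
    rintro x y ⟨k, rfl⟩ h
    by_contra! hne
    have hk : k ≠ 0 := right_ne_zero_of_mul hne.1
    have hk2 : 0 < k ^ 2 := by positivity
    have hy : 0 < y ^ 2 := by have := hne.2; positivity
    nlinarith [mul_le_mul_of_nonneg_left (Int.add_one_le_iff.2 hk2) (sq_nonneg (p : ℤ))]
  have hdvd : (p : ℤ) ∣ (a * d - b * c) * (a * d + b * c) :=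
    ⟨a ^ 2 - c ^ 2, by linear_combination c ^ 2 * hab - a ^ 2 * hcd⟩
  rcases hpp.dvd_or_dvd hdvd with h | h
  · rcases small _ (a * c + b * d) h
      (by linear_combination (-p : ℤ) * hcd - (c ^ 2 + d ^ 2) * hab) with h | h
    · exact same (by linear_combination (a * d + b * c) * h)
    · exact swap (by linear_combination (a * c - b * d) * h)
  · rcases small _ (a * c - b * d) h
      (by linear_combination (-p : ℤ) * hcd - (c ^ 2 + d ^ 2) * hab) with h | h
    · exact same (by linear_combination (a * d - b * c) * h)
    · exact swap (by linear_combination (a * c + b * d) * h)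

theorem exists_normalizedPair {n a b : ℤ} (hn : n % 4 = 1) (hab : n = a ^ 2 + b ^ 2) :
    ∃ c d : ℤ, AgreeUpToOrderAndSigns a b c d ∧ n = c ^ 2 + d ^ 2 ∧ NormalizedPair c d := by
  have odd_even : ∀ x y : ℤ, Odd x → Even y → n = x ^ 2 + y ^ 2 →
      ∃ c d : ℤ, ((c = x ∨ c = -x) ∧ d = y) ∧ n = c ^ 2 + d ^ 2 ∧ NormalizedPair c d := by
    intro x y hx hy h
    by_cases h3 : x % 4 = 3
    · exact ⟨x, y, ⟨Or.inl rfl, rfl⟩, h, h3, hy⟩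
    · refine ⟨-x, y, ⟨Or.inr rfl, rfl⟩, by rw [h, neg_sq], ?_, hy⟩
      have := Int.odd_iff.1 hx
      simp only [Int.ModEq]
      omega
  rcases Int.even_or_odd a with ha | ha <;> rcases Int.even_or_odd b with hb | hb
  · have : Even n := by
      rw [hab]
      exact (ha.pow_of_ne_zero two_ne_zero).add (hb.pow_of_ne_zero two_ne_zero)
    rw [Int.even_iff] at this; omega
  · obtain ⟨c, d, ⟨hc, hd⟩, h⟩ := odd_even b a hb ha (by rw [hab, add_comm])
    exact ⟨c, d, Or.inr ⟨hc, Or.inl hd⟩, h⟩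
  · obtain ⟨c, d, ⟨hc, hd⟩, h⟩ := odd_even a b ha hb hab
    exact ⟨c, d, Or.inl ⟨hc, Or.inl hd⟩, h⟩
  · have : Even n := by rw [hab]; exact ha.pow.add_odd hb.pow
    rw [Int.even_iff] at this; omega

/-! ### From the quadratic character to quartic residues -/

theorem five_pow_eq_quadraticChar {p : ℕ} [Fact p.Prime] (hp : p % 4 = 1) {r : ZMod p}
    (hr : r ^ 2 = 5) : (5 : ZMod p) ^ ((p - 1) / 4) = quadraticChar (ZMod p) r := by
  have h2 : ringChar (ZMod p) ≠ 2 := by rw [ZMod.ringChar_zmod_n]; omega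
  rw [quadraticChar_eq_pow_of_char_ne_two' h2, ZMod.card, ← hr, ← pow_mul]
  congr 1
  omega

theorem isPowerResidue_iff {m p : ℕ} {n : ℤ} :
    IsPowerResidue m n p ↔ ∃ x : ZMod p, x ^ m = n := by
  constructor
  · rintro ⟨x, hx⟩
    exact ⟨x, by exact_mod_cast (ZMod.intCast_eq_intCast_iff _ _ p).2 hx⟩
  · rintro ⟨x, hx⟩
    obtain ⟨y, rfl⟩ := ZMod.intCast_surjective x
    exact ⟨y, (ZMod.intCast_eq_intCast_iff _ _ p).1 (by exact_mod_cast hx)⟩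

theorem AdmissiblePrime.quartic_of_five_dvd_right {p : ℕ} (h : AdmissiblePrime p) {a b : ℤ}
    (hab : (p : ℤ) = a ^ 2 + b ^ 2) (ha : Odd a) (hb : (5 : ℤ) ∣ b) :
    (5 : ℤ) ^ ((p - 1) / 4) ≡ 1 [ZMOD p] ∧ IsPowerResidue 4 5 p := by
  have : Fact p.Prime := ⟨h.1⟩
  have hp4 : p % 4 = 1 := by have := h.2.1; simp only [Int.ModEq] at this; omega
  obtain ⟨r, hr⟩ := h.exists_sqrt_five
  have hc := (h.quadraticChar_sqrt_five hab ha hr).1 hb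
  constructor
  · apply (ZMod.intCast_eq_intCast_iff _ _ p).1
    push_cast
    rw [five_pow_eq_quadraticChar hp4 hr, hc]
    simp
  · have hr0 : r ≠ 0 := by rintro rfl; simp at hc
    obtain ⟨w, hw⟩ := (quadraticChar_one_iff_isSquare hr0).1 hc
    refine isPowerResidue_iff.2 ⟨w, ?_⟩
    push_cast
    rw [← hr, hw]; ring

theorem AdmissiblePrime.not_quartic_of_five_dvd_left {p : ℕ} (h : AdmissiblePrime p) {a b : ℤ}
    (hab : (p : ℤ) = a ^ 2 + b ^ 2) (ha : Odd a) (ha5 : (5 : ℤ) ∣ a) :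
    (5 : ℤ) ^ ((p - 1) / 4) ≡ -1 [ZMOD p] ∧ IsPowerResidue 2 5 p ∧ ¬ IsPowerResidue 4 5 p := by
  have : Fact p.Prime := ⟨h.1⟩
  have hp4 : p % 4 = 1 := by have := h.2.1; simp only [Int.ModEq] at this; omega
  obtain ⟨r, hr⟩ := h.exists_sqrt_five
  have hc := (h.quadraticChar_sqrt_five hab ha hr).2 ha5
  have hpow : (5 : ZMod p) ^ ((p - 1) / 4) = -1 := by
    rw [five_pow_eq_quadraticChar hp4 hr, hc]
    simp
  refine ⟨(ZMod.intCast_eq_intCast_iff _ _ p).1 (by push_cast; exact hpow),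
    isPowerResidue_iff.2 ⟨r, by push_cast; exact hr⟩, fun h4 => ?_⟩
  obtain ⟨x, hx⟩ := isPowerResidue_iff.1 h4
  push_cast at hx
  have : Fact (2 < p) := ⟨by have := h.1.two_le; omega⟩
  have h41 : 4 * ((p - 1) / 4) = p - 1 := by omega
  -- If `x⁴ = 5`, then `5 ^ ((p - 1) / 4) = x ^ (p - 1) = 1` by Fermat, against `hpow`.
  rw [← hx, ← pow_mul, h41, ZMod.pow_card_sub_one_eq_one] at hpow
  · exact ZMod.neg_one_ne_one hpow.symm
  · rintro rfl
    rw [zero_pow (by norm_num)] at hx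
    have h0 : r = 0 := by rw [← hx] at hr; exact pow_eq_zero_iff two_ne_zero |>.1 hr
    rw [h0] at hc
    simp at hc

/-! ### The main theorem -/

theorem mainTheorem6 :
    (∀ p : ℕ, AdmissiblePrime p →
      -- `p` is a sum of two squares, in an essentially unique way
      (∃ a b : ℤ, (p : ℤ) = a ^ 2 + b ^ 2) ∧
      (∀ a b c d : ℤ, (p : ℤ) = a ^ 2 + b ^ 2 → (p : ℤ) = c ^ 2 + d ^ 2 →
        AgreeUpToOrderAndSigns a b c d) ∧
      -- every decomposition can be normalized
      (∀ a b : ℤ, (p : ℤ) = a ^ 2 + b ^ 2 →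
        ∃ c d : ℤ, AgreeUpToOrderAndSigns a b c d ∧ (p : ℤ) = c ^ 2 + d ^ 2 ∧
          NormalizedPair c d) ∧
      -- the possibilities for a normalized decomposition
      (∀ a b : ℤ, (p : ℤ) = a ^ 2 + b ^ 2 → NormalizedPair a b →
        (((a ≡ 3 [ZMOD 20] ∨ a ≡ 7 [ZMOD 20] ∨ a ≡ 11 [ZMOD 20] ∨ a ≡ 19 [ZMOD 20]) ∧
            b ≡ 10 [ZMOD 20]) ∨
          (a ≡ 15 [ZMOD 20] ∧
            (b ≡ 2 [ZMOD 20] ∨ b ≡ 6 [ZMOD 20] ∨ b ≡ 14 [ZMOD 20] ∨ b ≡ 18 [ZMOD 20]))) ∧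
        (b ≡ 10 [ZMOD 20] →
          (5 : ℤ) ^ ((p - 1) / 4) ≡ 1 [ZMOD p] ∧ IsPowerResidue 4 5 p) ∧
        (a ≡ 15 [ZMOD 20] →
          (5 : ℤ) ^ ((p - 1) / 4) ≡ -1 [ZMOD p] ∧
            IsPowerResidue 2 5 p ∧ ¬ IsPowerResidue 4 5 p))) ∧
    -- the residue patterns modulo 20 that occur are exactly the eight listed ones
    {q : ZMod 20 × ZMod 20 | ∃ (p : ℕ) (a b : ℤ), AdmissiblePrime p ∧
        (p : ℤ) = a ^ 2 + b ^ 2 ∧ NormalizedPair a b ∧ q = ((a : ZMod 20), (b : ZMod 20))} =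
      {(3, 10), (7, 10), (11, 10), (19, 10), (15, 2), (15, 6), (15, 14), (15, 18)} := by
  refine ⟨fun p h => ?_, ?_⟩
  · have : Fact p.Prime := ⟨h.1⟩
    have hp4 : p % 4 = 1 := by have := h.2.1; simp only [Int.ModEq] at this; omega
    have odd_of : ∀ a b : ℤ, NormalizedPair a b → Odd a := fun a b hn => by
      have := hn.1
      simp only [Int.ModEq] at this
      rw [Int.odd_iff]; omega
    refine ⟨?_, fun a b c d => agreeUpToOrderAndSigns_of_prime h.1,
      fun a b hab => exists_normalizedPair (by omega) hab, fun a b hab hn =>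
        ⟨h.residues hab hn, fun hb => ?_, fun ha => ?_⟩⟩
    · obtain ⟨a, b, hab⟩ := Nat.Prime.sq_add_sq (p := p) (by omega)
      exact ⟨a, b, by exact_mod_cast hab.symm⟩
    · refine h.quartic_of_five_dvd_right hab (odd_of a b hn) ?_
      simp only [Int.ModEq] at hb; omega
    · refine h.not_quartic_of_five_dvd_left hab (odd_of a b hn) ?_
      simp only [Int.ModEq] at ha; omega
  · ext ⟨x, y⟩
    simp only [Set.mem_ofPred_eq, Set.mem_insert_iff, Set.mem_singleton_iff, Prod.mk.injEq]
    constructor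
    · rintro ⟨p, a, b, h, hab, hn, rfl, rfl⟩
      have hz : ∀ u v : ℤ, u ≡ v [ZMOD 20] → (u : ZMod 20) = (v : ZMod 20) :=
        fun u v h => (ZMod.intCast_eq_intCast_iff _ _ 20).2 h
      rcases h.residues hab hn with ⟨h | h | h | h, h'⟩ | ⟨h, h' | h' | h' | h'⟩ <;>
        rw [hz _ _ h, hz _ _ h'] <;> decide
    · have mk : ∀ (p : ℕ) (a b : ℤ), AdmissiblePrime p → (p : ℤ) = a ^ 2 + b ^ 2 →
          NormalizedPair a b → (a : ZMod 20) = x → (b : ZMod 20) = y →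
          ∃ (p : ℕ) (a b : ℤ), AdmissiblePrime p ∧ (p : ℤ) = a ^ 2 + b ^ 2 ∧
            NormalizedPair a b ∧ x = (a : ZMod 20) ∧ y = (b : ZMod 20) :=
        fun p a b h1 h2 h3 h4 h5 => ⟨p, a, b, h1, h2, h3, h4.symm, h5.symm⟩
      rintro (⟨rfl, rfl⟩ | ⟨rfl, rfl⟩ | ⟨rfl, rfl⟩ | ⟨rfl, rfl⟩ | ⟨rfl, rfl⟩ | ⟨rfl, rfl⟩ |
        ⟨rfl, rfl⟩ | ⟨rfl, rfl⟩)
      -- Negative values of `a` put it in the class 3 modulo 4; changing the sign of `b` lets 29 and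
      -- 61 each serve twice.
      · exact mk 109 3 10 ⟨by norm_num, by decide, by decide⟩ (by norm_num)
          ⟨by decide, by decide⟩ (by decide) (by decide)
      · exact mk 149 7 10 ⟨by norm_num, by decide, by decide⟩ (by norm_num)
          ⟨by decide, by decide⟩ (by decide) (by decide)
      · exact mk 181 (-9) 10 ⟨by norm_num, by decide, by decide⟩ (by norm_num)
          ⟨by decide, by decide⟩ (by decide) (by decide)
      · exact mk 101 (-1) 10 ⟨by norm_num, by decide, by decide⟩ (by norm_num)
          ⟨by decide, by decide⟩ (by decide) (by decide)
      · exact mk 29 (-5) 2 ⟨by norm_num, by decide, by decide⟩ (by norm_num)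
          ⟨by decide, by decide⟩ (by decide) (by decide)
      · exact mk 61 (-5) 6 ⟨by norm_num, by decide, by decide⟩ (by norm_num)
          ⟨by decide, by decide⟩ (by decide) (by decide)
      · exact mk 61 (-5) (-6) ⟨by norm_num, by decide, by decide⟩ (by norm_num)
          ⟨by decide, by decide⟩ (by decide) (by decide)
      · exact mk 29 (-5) (-2) ⟨by norm_num, by decide, by decide⟩ (by norm_num)
          ⟨by decide, by decide⟩ (by decide) (by decide)
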